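/- **Systems.** A causal (single-channel) LTI system is given by its real impulse response $g_0,g_1,\dots$, equivalently by its transfer function $\hat G(z)=\sum_k g_k z^{-k}$, which is assumed rational; it starts at rest, $(Gu)^t=\sum_{k=0}^t g_k u^{t-k}$. It is strictly causal if $g_0=0$. Systems with several inputs and outputs are matrices of such systems. **Optimization method.** A causal SISO system $G$ is an optimization method if for all sufficiently small $\epsilon>0$ and all $y^\star\in\mathbb R$ the loop $y=Gu$, $u^t=f'(y^t)+e^t$ with $f(y)=\frac{\epsilon}{2}(y-y^\star)^2$ is well posed and $y^t\to y^\star$, and if for $f=0$ (that is, $\epsilon=0$) $y^t$ converges to a constant. Here $e$ is an arbitrary signal that vanishes from some time on; it sets the initial condition. **Networks.** For a network of $n$ agents with weights $a_{ij}\ge 0$, $A=[a_{ij}]$, the Laplacian is $L=\mathrm{diag}(A\mathbf 1)-A$. The network is connected if there is a directed path from any agent to any other; $L$ is balanced if $L^{\mathsf T}\mathbf 1=0$. All agents run a causal LTI system with inputs $(u_i,v_i)$ and outputs $(y_i,z_i)$, where $u_i,y_i$ are scalar and $v_i,z_i$ are $m$-dimensional, and $v_i=\sum_j a_{ij}(z_i-z_j)$.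 The system is partitioned accordingly into blocks $11,12,21,22$. **Consensus estimator.** $G$ is a consensus estimator of order $\ell$ for $n$ agents if there is $\delta>0$ such that, for every connected network of $n$ agents with balanced, diagonalizable Laplacian of spectral radius $<\delta$, and all inputs $u_i=w_i$ that are polynomials in $t$ of degree at most $\ell-1$ with constant mean $w^\star=\frac1n\sum_j w_j^t$, the interconnection is well posed and $y_i^t\to w^\star$ for all $i$. **Distributed optimization algorithm.** $H$ is a distributed optimization algorithm for $n$ agents if there is $\delta>0$ such that, for every connected network of $n$ agents with balanced Laplacian of spectral radius $<\delta$: (a) for all sufficiently small $\epsilon>0$ and all $y_1^\star,\dots,y_n^\star$, the interconnection with $u_i^t=f_i'(y_i^t)+e_i^t$, $f_i(y)=\frac{\epsilon}{2}(y-y_i^\star)^2$, is well posed and $y_i^t\to\frac1n\sum_j y_j^\star$ for all $i$; (b) when all $f_i=0$, all $y_i^t$ converge to a common constant. Again the $e_i$ are arbitrary signals that vanish from some time on. **Theorem.** Let $N$ be a nonempty set of positive integers (for example a single $n$, or all of them). Let $H$ be a causal LTI system with rational transfer matrix such that $H^{22}$ and $H^{21}H^{12}$ are strictly causal and $H$ is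 a distributed optimization algorithm for $n$ agents for every $n\in N$. 1. There are a causal LTI optimization method $G_{\mathrm{opt}}$ and a causal LTI system $G_{\mathrm{con}}$, both with rational transfer functions and with $G_{\mathrm{con}}^{22}$ strictly causal, such that $G_{\mathrm{con}}$ is a consensus estimator of order two for $n$ agents for every $n\in N$, and $$H=G_{\mathrm{con}}\begin{bmatrix}G_{\mathrm{opt}}&0\\0&I_m\end{bmatrix}.$$ 2. If $H^{11}$ is strictly causal, then $G_{\mathrm{opt}}$ can be chosen strictly causal, with $G_{\mathrm{con}}$ as in part 1 and with the factorization holding up to a change of the network variables by a delay, which does not alter the closed-loop map from $(u_i)$ to $(y_i)$: for some integer $q\ge0$, with $\hat F(z)=z^{-q}I_m$, $$\begin{bmatrix}1&0\\0&\hat F\end{bmatrix}\hat H\begin{bmatrix}1&0\\0&\hat F^{-1}\end{bmatrix}=\hat G_{\mathrm{con}}\begin{bmatrix}\hat G_{\mathrm{opt}}&0\\0&I_m\end{bmatrix}.$$ If moreover $H^{21}$ is strictly causal, this holds with $q=0$, that is, as an exact factorization of $H$. -/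

import Mathlib

open Filter Topology

noncomputable section

namespace DistOpt

/-! ### Causal LTI systems

A causal discrete-time scalar LTI system is given by its impulse response `g₀, g₁, g₂, …`, stored as
the power series `∑ gₖ Xᵏ`.  The variable `X` is the unit delay `z⁻¹`, so this series is the
expansion at `z = ∞` of the transfer function, and the series connection of two systems is the
product of their series.  A system with several inputs and outputs is a matrix of such series. -/

/-- The output of the system `g`, initially at rest, for the input `u` (convolution):
`yᵗ = ∑_{k + s = t} gₖ uˢ`. -/
def response (g : PowerSeries ℝ) (u : ℕ → ℝ) : ℕ → ℝ :=
  fun t => ∑ p ∈ Finset.HasAntidiagonal.antidiagonal t, PowerSeries.coeff p.1 g * u p.2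

/-- The output of a system with several inputs and outputs. -/
def mresponse {κ ι : Type*} [Fintype ι] (G : Matrix κ ι (PowerSeries ℝ)) (u : ι → ℕ → ℝ) :
    κ → ℕ → ℝ :=
  fun k t => ∑ j, response (G k j) (u j) t

/-- The transfer function is rational, that is, the system is finite-dimensional. -/
def IsRational (g : PowerSeries ℝ) : Prop :=
  ∃ p q : Polynomial ℝ, q.coeff 0 ≠ 0 ∧ (q : PowerSeries ℝ) * g = (p : PowerSeries ℝ)

/-- Every entry of the transfer matrix is rational. -/
def MIsRational {κ ι : Type*} (G : Matrix κ ι (PowerSeries ℝ)) : Prop :=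
  ∀ k j, IsRational (G k j)

/-- Strict causality: no direct feedthrough. -/
def StrictlyCausal (g : PowerSeries ℝ) : Prop := PowerSeries.constantCoeff g = 0

/-- Strict causality of a system with several inputs and outputs. -/
def MStrictlyCausal {κ ι : Type*} (G : Matrix κ ι (PowerSeries ℝ)) : Prop :=
  ∀ k j, StrictlyCausal (G k j)

/-- The local system of an agent: inputs `(u, v)` and outputs `(y, z)`, where `u` and `y` are scalar
and `v` and `z` have dimension `m`.  Its blocks are `toBlocks₁₁, …, toBlocks₂₂`. -/
abbrev AgentSystem (m : ℕ) : Type :=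
  Matrix (Unit ⊕ Fin m) (Unit ⊕ Fin m) (PowerSeries ℝ)

/-- The block diagonal system `diag(g, I_m)`. -/
def diagOne (m : ℕ) (g : PowerSeries ℝ) : AgentSystem m :=
  Matrix.fromBlocks (Matrix.of fun _ _ => g) 0 0 1

/-- The block diagonal system `diag(1, z^{-q} I_m)`, where `z⁻¹` is the unit delay. -/
def delayBlock (m q : ℕ) : AgentSystem m :=
  Matrix.fromBlocks 1 0 0 ((PowerSeries.X ^ q : PowerSeries ℝ) • (1 : Matrix _ _ (PowerSeries ℝ)))

/-! ### Optimization methods -/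

/-- The test function `f(x) = (ε/2) (x - y⋆)²`. -/
def quad (ε ystar : ℝ) : ℝ → ℝ := fun x => ε / 2 * (x - ystar) ^ 2

/-- A signal that vanishes from some time on.  Such a signal is added to the gradient to set the
initial condition: the states that it produces in a system at rest are exactly the states that the
system can reach through this input. -/
def IsTransient (e : ℕ → ℝ) : Prop := ∀ᶠ t in atTop, e t = 0

/-- The signals `y`, `u` satisfy the equations of the feedback loop of `G` with the gradient of `f`,
started by the transient `e`. -/
def OptLoop (G : PowerSeries ℝ) (f : ℝ → ℝ) (e y u : ℕ → ℝ) : Prop :=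
  y = response G u ∧ ∀ t, u t = deriv f (y t) + e t

/-- `G` is an optimization method: for all small `ε > 0` and all `y⋆`, the loop of `G` with the
gradient of `(ε/2) |y - y⋆|²` is well posed and `yᵗ → y⋆`; and `yᵗ` converges to a constant when
`ε = 0`. -/
def IsOptimizationMethod (G : PowerSeries ℝ) : Prop :=
  (∃ ε₀ > 0, ∀ ε : ℝ, 0 < ε → ε < ε₀ → ∀ ystar : ℝ, ∀ e : ℕ → ℝ, IsTransient e →
    (∃ y u, OptLoop G (quad ε ystar) e y u) ∧
    ∀ y u, OptLoop G (quad ε ystar) e y u → Tendsto y atTop (𝓝 ystar)) ∧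
  ∀ e : ℕ → ℝ, IsTransient e → ∀ y u, OptLoop G (fun _ => 0) e y u → ∃ c, Tendsto y atTop (𝓝 c)

/-! ### Networks -/

/-- The Laplacian `diag(A 1) - A` of a weighted directed network with adjacency matrix `A`. -/
def laplacian {n : ℕ} (A : Matrix (Fin n) (Fin n) ℝ) : Matrix (Fin n) (Fin n) ℝ :=
  Matrix.diagonal (A.mulVec 1) - A

/-- The weights are nonnegative, and there is a (directed) path from any agent to any other. -/
def IsConnectedNetwork {n : ℕ} (A : Matrix (Fin n) (Fin n) ℝ) : Prop :=
  (∀ i j, 0 ≤ A i j) ∧ ∀ i j, Relation.ReflTransGen (fun a b => A a b ≠ 0) i j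

/-- Balanced: `Lᵀ 1 = 0`. -/
def IsBalanced {n : ℕ} (L : Matrix (Fin n) (Fin n) ℝ) : Prop := L.transpose.mulVec 1 = 0

/-- `L` as a complex matrix. -/
def toComplex {n : ℕ} (L : Matrix (Fin n) (Fin n) ℝ) : Matrix (Fin n) (Fin n) ℂ :=
  L.map (fun x : ℝ => (x : ℂ))

/-- `L` is diagonalizable over `ℂ`. -/
def IsDiagonalizable {n : ℕ} (L : Matrix (Fin n) (Fin n) ℝ) : Prop :=
  ∃ (P : Matrix (Fin n) (Fin n) ℂ) (d : Fin n → ℂ),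
    IsUnit P ∧ toComplex L * P = P * Matrix.diagonal d

/-- The spectral radius of `L` is less than `δ`. -/
def SpectralRadiusLT {n : ℕ} (L : Matrix (Fin n) (Fin n) ℝ) (δ : ℝ) : Prop :=
  spectralRadius ℂ (toComplex L) < ENNReal.ofReal δ

/-- All agents `i` run the system `G` on their inputs `(uᵢ, vᵢ)`, with outputs `(yᵢ, zᵢ)`, and
exchange `vᵢ = ∑ⱼ aᵢⱼ (zᵢ - zⱼ)` over the network with adjacency matrix `A`. -/
def NetworkLoop {n m : ℕ} (G : AgentSystem m) (A : Matrix (Fin n) (Fin n) ℝ)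
    (u : Fin n → ℕ → ℝ) (v : Fin n → Fin m → ℕ → ℝ)
    (y : Fin n → ℕ → ℝ) (z : Fin n → Fin m → ℕ → ℝ) : Prop :=
  (∀ i, Sum.elim (fun _ => y i) (z i) = mresponse G (Sum.elim (fun _ => u i) (v i))) ∧
  ∀ i k t, v i k t = ∑ j, A i j * (z i k t - z j k t)

/-! ### Consensus estimators -/

/-- `G` is a consensus estimator of order `ℓ` for networks of `n` agents: for every connected network
whose Laplacian is balanced, diagonalizable and of small enough spectral radius, and for all inputs
`wᵢᵗ` that are polynomials in `t` of degree at most `ℓ - 1` with constant mean `w⋆`, the loop is well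
posed and each `yᵢᵗ` converges to `w⋆`. -/
def IsConsensusEstimator (n ℓ : ℕ) {m : ℕ} (G : AgentSystem m) : Prop :=
  ∃ δ > 0, ∀ A : Matrix (Fin n) (Fin n) ℝ, IsConnectedNetwork A → IsBalanced (laplacian A) →
    IsDiagonalizable (laplacian A) → SpectralRadiusLT (laplacian A) δ →
    ∀ (w : Fin n → Polynomial ℝ) (wstar : ℝ), (∀ i, (w i).degree < ℓ) →
      (∀ t : ℕ, (1 / (n : ℝ)) * ∑ j, (w j).eval (t : ℝ) = wstar) →
      (∃ v y z, NetworkLoop G A (fun i t => (w i).eval (t : ℝ)) v y z) ∧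
      ∀ v y z, NetworkLoop G A (fun i t => (w i).eval (t : ℝ)) v y z →
        ∀ i, Tendsto (y i) atTop (𝓝 wstar)

/-! ### Distributed optimization algorithms -/

/-- The signals satisfy the equations of the feedback loop of `H` on all agents with the network and
with the gradients of the local functions `fᵢ`, started by the transients `eᵢ`. -/
def DistLoop {n m : ℕ} (H : AgentSystem m) (A : Matrix (Fin n) (Fin n) ℝ) (f : Fin n → ℝ → ℝ)
    (e : Fin n → ℕ → ℝ) (u : Fin n → ℕ → ℝ) (v : Fin n → Fin m → ℕ → ℝ)
    (y : Fin n → ℕ → ℝ) (z : Fin n → Fin m → ℕ → ℝ) : Prop :=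
  NetworkLoop H A u v y z ∧ ∀ i t, u i t = deriv (f i) (y i t) + e i t

/-- `H` is a distributed optimization algorithm for networks of `n` agents: for every connected
network whose Laplacian is balanced and of small enough spectral radius, (a) for all small `ε > 0`
and all `yᵢ⋆`, the loop with `fᵢ(x) = (ε/2) |x - yᵢ⋆|²` is well posed and each `yᵢᵗ` converges to the
mean of the `yⱼ⋆`; (b) if all `fᵢ` are zero, all `yᵢᵗ` converge to a common constant. -/
def IsDistributedOptimizationAlgorithm (n : ℕ) {m : ℕ} (H : AgentSystem m) : Prop :=
  ∃ δ > 0, ∀ A : Matrix (Fin n) (Fin n) ℝ, IsConnectedNetwork A → IsBalanced (laplacian A) →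
    SpectralRadiusLT (laplacian A) δ →
    (∃ ε₀ > 0, ∀ ε : ℝ, 0 < ε → ε < ε₀ →
      ∀ (ystar : Fin n → ℝ) (e : Fin n → ℕ → ℝ), (∀ i, IsTransient (e i)) →
        (∃ u v y z, DistLoop H A (fun i => quad ε (ystar i)) e u v y z) ∧
        ∀ u v y z, DistLoop H A (fun i => quad ε (ystar i)) e u v y z →
          ∀ i, Tendsto (y i) atTop (𝓝 ((1 / (n : ℝ)) * ∑ j, ystar j))) ∧
    ∀ e : Fin n → ℕ → ℝ, (∀ i, IsTransient (e i)) →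
      ∀ u v y z, DistLoop H A (fun _ _ => 0) e u v y z →
        ∃ c : ℝ, ∀ i, Tendsto (y i) atTop (𝓝 c)

end DistOpt

end

open Filter Topology

noncomputable section

namespace DistOpt

/-! The optimization method can be a bare integrator. Let `k` be the limit of the impulse response
`h` of the block `H¹¹`. Take `G_opt = k / (1 - X)`, with an extra factor `X` when strict causality
is wanted, and obtain `G_con` by multiplying the first column of `H` by `k⁻¹ (1 - X)` and cancelling
the delay. It remains to see that `k` exists and is negative, so that the integrator optimizes, and
that `G_con` reaches consensus.

Let `Q` be the closed-loop matrix from `(uᵢ)` to `(yᵢ)`. Its columns sum to `h` because the network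
is balanced, and the case of zero objectives makes the entries of each column converge to a common
constant. So `k` exists and every entry tends to `k / n`; being rational, it is `k / n` times the
unit step plus an absolutely summable part (`IsRational.summable_sub`).

The sign is `integrator_gain_neg`: if `k = 0`, then `h` is stable and a vanishing gradient cannot
hold the output at a nonzero target; if `k > 0`, then `ε h(x) = 1` at some `x` in `[0, 1)`, and the
loop equation is contradictory there.

For consensus, differencing turns an affine input into an impulse `wᵢ(0)` plus a delayed constant
`bᵢ` with `∑ bᵢ = 0`. The impulses produce `k w⋆`. The constants produce zero in the limit
(`convergesTo_mulVec_step`): in the quadratic loop with targets `bᵢ` all outputs tend to zero, and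
the loop equation expresses the response to the `bᵢ` through these outputs. -/

/-! ### Summability of stable rational impulse responses -/

/-- A nonnegative sequence that is halved by every `s` steps is summable. -/
lemma summable_of_half_le {a : ℕ → ℝ} (ha : ∀ t, 0 ≤ a t) (s : ℕ)
    (hs : ∀ t, a (t + s) ≤ 1 / 2 * a t) : Summable a := by
  -- With `S t` the partial sums, `S t ≤ S (s + t) ≤ S s + S t / 2`, whence the bound `2 * S s`.
  refine summable_of_sum_range_le (c := 2 * ∑ i ∈ Finset.range s, a i) ha fun t => ?_
  have h1 : ∑ i ∈ Finset.range t, a i ≤ ∑ i ∈ Finset.range (s + t), a i :=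
    Finset.sum_le_sum_of_subset_of_nonneg
      (Finset.range_subset_range.2 (Nat.le_add_left t s)) fun i _ _ => ha i
  have h2 : ∑ i ∈ Finset.range t, a (s + i) ≤ 1 / 2 * ∑ i ∈ Finset.range t, a i := by
    rw [Finset.mul_sum]
    exact Finset.sum_le_sum fun i _ => by rw [add_comm]; exact hs i
  rw [Finset.sum_range_add] at h1
  linarith

/-- In finite dimension, an orbit of a linear map that tends to zero is absolutely summable. -/
lemma summable_norm_orbit {E : Type*} [NormedAddCommGroup E] [NormedSpace ℝ E]
    [FiniteDimensional ℝ E] (M : E →ₗ[ℝ] E) (x : E)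
    (hx : Tendsto (fun t : ℕ => (M ^ t) x) atTop (𝓝 0)) :
    Summable fun t : ℕ => ‖(M ^ t) x‖ := by
  -- `M` may be unstable elsewhere; on the span of the orbit its powers tend to zero on a finite
  -- basis, hence in operator norm.
  set W : Submodule ℝ E := Submodule.span ℝ (Set.range fun t : ℕ => (M ^ t) x)
  have hW : ∀ w ∈ W, Tendsto (fun t : ℕ => (M ^ t) w) atTop (𝓝 0) := by
    intro w hw
    induction hw using Submodule.span_induction with
    | mem w hw =>
      obtain ⟨r, rfl⟩ := hw
      have := (tendsto_add_atTop_iff_nat r).2 hx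
      simpa only [pow_add, Module.End.mul_apply] using this
    | zero => simp
    | add u v _ _ hu hv => simpa using hu.add hv
    | smul c u _ hu => simpa using hu.const_smul c
  let b := Module.finBasis ℝ W
  let R := LinearMap.toContinuousLinearMap b.equivFun.toLinearMap
  have hsum : Tendsto (fun t : ℕ => ‖R‖ * ∑ i, ‖(M ^ t) (b i : E)‖) atTop (𝓝 0) := by
    have : Tendsto (fun t : ℕ => ∑ i, ‖(M ^ t) (b i : E)‖) atTop (𝓝 (∑ i, (0 : ℝ))) :=
      tendsto_finsetSum _ fun i _ => by simpa using (hW (b i) (b i).2).norm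
    simpa using this.const_mul ‖R‖
  obtain ⟨s, hs⟩ := (hsum.eventually (gt_mem_nhds (show (0 : ℝ) < 1 / 2 by norm_num))).exists
  have key : ∀ w : W, ‖(M ^ s) (w : E)‖ ≤ 1 / 2 * ‖w‖ := by
    intro w
    have hw : (w : E) = ∑ i, R w i • (b i : E) := by
      conv_lhs => rw [← b.sum_equivFun w, Submodule.coe_sum]
      rfl
    calc ‖(M ^ s) (w : E)‖ = ‖∑ i, R w i • (M ^ s) (b i : E)‖ := by
          conv_lhs => rw [hw]
          simp
      _ ≤ ∑ i, ‖R w‖ * ‖(M ^ s) (b i : E)‖ := by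
          refine (norm_sum_le _ _).trans (Finset.sum_le_sum fun i _ => ?_)
          rw [norm_smul]
          gcongr
          exact norm_le_pi_norm _ i
      _ = ‖R w‖ * ∑ i, ‖(M ^ s) (b i : E)‖ := by rw [Finset.mul_sum]
      _ ≤ ‖R‖ * ‖w‖ * ∑ i, ‖(M ^ s) (b i : E)‖ := by
          gcongr
          exact R.le_opNorm w
      _ = (‖R‖ * ∑ i, ‖(M ^ s) (b i : E)‖) * ‖w‖ := by ring
      _ ≤ 1 / 2 * ‖w‖ := by gcongr
  refine summable_of_half_le (fun _ => norm_nonneg _) s fun t => ?_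
  have := key ⟨(M ^ t) x, Submodule.subset_span ⟨t, rfl⟩⟩
  rw [add_comm, pow_add]
  simpa using this

/-- A sequence with a linear recurrence that tends to zero is absolutely summable. -/
lemma summable_abs_of_recurrence {K : ℕ} (hK : 0 < K) (g : ℕ → ℝ) (a : Fin K → ℝ)
    (hrec : ∀ t, g (t + K) = ∑ j : Fin K, a j * g (t + j))
    (hg : Tendsto g atTop (𝓝 0)) : Summable fun t => |g t| := by
  -- The companion map, which shifts a window of `K` consecutive values.
  let M : (Fin K → ℝ) →ₗ[ℝ] (Fin K → ℝ) := LinearMap.pi fun j =>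
    if hj : (j : ℕ) + 1 < K then LinearMap.proj ⟨j + 1, hj⟩ else ∑ i, a i • LinearMap.proj i
  have hM : ∀ t : ℕ, M (fun j : Fin K => g (t + j)) = fun j : Fin K => g (t + 1 + j) := by
    intro t
    ext j
    by_cases hj : (j : ℕ) + 1 < K
    · simp [M, hj, add_assoc, add_comm 1]
    · have : (j : ℕ) + 1 = K := by have := j.2; omega
      have h2 : g (t + 1 + j) = g (t + K) := by congr 1; omega
      simp [M, hj, h2, hrec, LinearMap.sum_apply]
  have hpow : ∀ t : ℕ, (M ^ t) (fun j => g j) = fun j : Fin K => g (t + j) := by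
    intro t
    induction t with
    | zero => simp
    | succ t ih => rw [pow_succ', Module.End.mul_apply, ih, hM]
  have := summable_norm_orbit M (fun j => g j) (by
    simp only [hpow]
    rw [tendsto_pi_nhds]
    intro j
    exact (tendsto_add_atTop_iff_nat (j : ℕ)).2 hg)
  refine this.of_nonneg_of_le (fun _ => abs_nonneg _) fun t => ?_
  rw [hpow]
  simpa using norm_le_pi_norm (fun j : Fin K => g (t + j)) ⟨0, hK⟩

/-- The denominator gives a linear recurrence, so stability follows without locating poles. -/
lemma IsRational.summable_abs {g : PowerSeries ℝ} (hg : IsRational g)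
    (h0 : Tendsto (fun t => PowerSeries.coeff t g) atTop (𝓝 0)) :
    Summable fun t => |PowerSeries.coeff t g| := by
  obtain ⟨p, q, hq, hpq⟩ := hg
  -- Large enough that at times `t + K` the numerator no longer contributes and the recurrence
  -- reaches back at most `K` steps.
  set K := p.natDegree + q.natDegree + 1
  have hconv : ∀ t, PowerSeries.coeff (t + K) g =
      ∑ j : Fin K, (-(q.coeff (K - j) / q.coeff 0)) * PowerSeries.coeff (t + j) g := by
    intro t
    have h1 := congrArg (PowerSeries.coeff (t + K)) hpq
    rw [mul_comm, PowerSeries.coeff_mul, Polynomial.coeff_coe,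
      Polynomial.coeff_eq_zero_of_natDegree_lt (by omega),
      Finset.Nat.sum_antidiagonal_eq_sum_range_succ
        (fun i j => PowerSeries.coeff i g * PowerSeries.coeff j (q : PowerSeries ℝ)),
      Finset.sum_range_succ, add_comm t K] at h1
    rw [add_comm K t, Finset.sum_range_add, Finset.sum_eq_zero, zero_add] at h1
    · have h2 : ∑ j : Fin K, (-(q.coeff (K - j) / q.coeff 0)) * PowerSeries.coeff (t + j) g =
          -(∑ j ∈ Finset.range K, PowerSeries.coeff (t + j) g * q.coeff (K - j)) / q.coeff 0 := by
        rw [Fin.sum_univ_eq_sum_range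
          (fun j => (-(q.coeff (K - j) / q.coeff 0)) * PowerSeries.coeff (t + j) g) K,
          ← Finset.sum_neg_distrib, Finset.sum_div]
        exact Finset.sum_congr rfl fun j _ => by ring
      rw [h2, eq_div_iff hq]
      simp only [Nat.sub_self, Polynomial.coeff_coe, Nat.add_sub_add_left] at h1
      linarith
    · intro i hi
      rw [Finset.mem_range] at hi
      rw [Polynomial.coeff_coe, Polynomial.coeff_eq_zero_of_natDegree_lt (by omega), mul_zero]
  exact summable_abs_of_recurrence (Nat.succ_pos _) _ _ hconv h0

/-! ### Rational series -/

/-- The ring of rational impulse responses. -/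
def rationalSubring : Subring (PowerSeries ℝ) where
  carrier := {g | IsRational g}
  mul_mem' := by
    rintro a b ⟨p, q, hq, h⟩ ⟨p', q', hq', h'⟩
    refine ⟨p * p', q * q', by simp [Polynomial.mul_coeff_zero, hq, hq'], ?_⟩
    rw [Polynomial.coe_mul, Polynomial.coe_mul, ← h, ← h']
    ring
  one_mem' := ⟨1, 1, by simp, by simp⟩
  add_mem' := by
    rintro a b ⟨p, q, hq, h⟩ ⟨p', q', hq', h'⟩
    refine ⟨p * q' + p' * q, q * q', by simp [Polynomial.mul_coeff_zero, hq, hq'], ?_⟩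
    rw [Polynomial.coe_mul, Polynomial.coe_add, Polynomial.coe_mul, Polynomial.coe_mul,
      ← h, ← h']
    ring
  zero_mem' := ⟨0, 1, by simp, by simp⟩
  neg_mem' := by
    rintro a ⟨p, q, hq, h⟩
    exact ⟨-p, q, hq, by rw [Polynomial.coe_neg, ← h, mul_neg]⟩

lemma isRational_coe (p : Polynomial ℝ) : IsRational (p : PowerSeries ℝ) := ⟨p, 1, by simp, by simp⟩

lemma isRational_C (c : ℝ) : IsRational (PowerSeries.C c) := by
  simpa using isRational_coe (Polynomial.C c)

lemma isRational_X : IsRational PowerSeries.X := by simpa using isRational_coe Polynomial.X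

lemma IsRational.mul {a b : PowerSeries ℝ} (ha : IsRational a) (hb : IsRational b) :
    IsRational (a * b) := rationalSubring.mul_mem ha hb

lemma IsRational.sub {a b : PowerSeries ℝ} (ha : IsRational a) (hb : IsRational b) :
    IsRational (a - b) := rationalSubring.sub_mem ha hb

lemma IsRational.of_mul_eq_one {g h : PowerSeries ℝ} (hg : IsRational g) (hgh : g * h = 1) :
    IsRational h := by
  obtain ⟨p, q, hq, hpq⟩ := hg
  refine ⟨q, p, ?_, by rw [← hpq, mul_assoc, hgh, mul_one]⟩
  have h1 := congrArg PowerSeries.constantCoeff hpq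
  have h2 := congrArg PowerSeries.constantCoeff hgh
  simp only [map_mul, map_one, ← PowerSeries.coeff_zero_eq_constantCoeff_apply,
    Polynomial.coeff_coe] at h1 h2
  rw [← h1]
  exact mul_ne_zero hq (left_ne_zero_of_mul_eq_one h2)

lemma IsRational.of_X_mul {g : PowerSeries ℝ} (hg : IsRational (PowerSeries.X * g)) :
    IsRational g := by
  obtain ⟨p, q, hq, hpq⟩ := hg
  have h1 := congrArg PowerSeries.constantCoeff hpq
  rw [map_mul, map_mul, PowerSeries.constantCoeff_X, zero_mul, mul_zero,
    ← PowerSeries.coeff_zero_eq_constantCoeff_apply, Polynomial.coeff_coe] at h1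
  obtain ⟨r, rfl⟩ := Polynomial.X_dvd_iff.2 h1.symm
  refine ⟨r, q, hq, mul_left_cancel₀ PowerSeries.X_ne_zero ?_⟩
  rw [Polynomial.coe_mul, Polynomial.coe_X] at hpq
  rw [← hpq]
  ring

/-- A rational matrix with identity feedthrough has a rational inverse. -/
lemma exists_rational_inverse {ι : Type*} [Fintype ι] [DecidableEq ι]
    (M : Matrix ι ι (PowerSeries ℝ)) (hM : MIsRational M)
    (h1 : M.map PowerSeries.constantCoeff = 1) :
    ∃ M' : Matrix ι ι (PowerSeries ℝ), MIsRational M' ∧ M * M' = 1 ∧ M' * M = 1 := by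
  -- Inverting over the subring makes the inverse rational; the determinant is a unit there because
  -- its constant coefficient is 1.
  let R : Matrix ι ι rationalSubring := Matrix.of fun i j => ⟨M i j, hM i j⟩
  have hR : R.map rationalSubring.subtype = M := by ext i j; rfl
  have hdet : rationalSubring.subtype R.det = M.det := by
    rw [RingHom.map_det, RingHom.mapMatrix_apply, hR]
  have hc : PowerSeries.constantCoeff M.det = 1 := by
    rw [RingHom.map_det, RingHom.mapMatrix_apply, h1, Matrix.det_one]
  have hu : IsUnit R.det := by
    have : IsUnit M.det := by rw [PowerSeries.isUnit_iff_constantCoeff, hc]; exact isUnit_one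
    obtain ⟨d, hd⟩ := this.exists_right_inv
    have hdr : IsRational d := IsRational.of_mul_eq_one (hdet ▸ R.det.2) hd
    refine IsUnit.of_mul_eq_one ⟨d, hdr⟩ (Subtype.ext ?_)
    change rationalSubring.subtype R.det * d = 1
    rw [hdet, hd]
  refine ⟨R⁻¹.map rationalSubring.subtype, fun i j => (R⁻¹ i j).2, ?_, ?_⟩
  · conv_lhs => rw [← hR, ← Matrix.map_mul, Matrix.mul_nonsing_inv _ hu]
    simp
  · conv_lhs => rw [← hR, ← Matrix.map_mul, Matrix.nonsing_inv_mul _ hu]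
    simp

/-! ### Steady states -/

/-- The impulse response (or signal) `g` converges to `c`. -/
def ConvergesTo (g : PowerSeries ℝ) (c : ℝ) : Prop :=
  Tendsto (fun t => PowerSeries.coeff t g) atTop (𝓝 c)

lemma ConvergesTo.add {g h : PowerSeries ℝ} {c d : ℝ} (hg : ConvergesTo g c)
    (hh : ConvergesTo h d) : ConvergesTo (g + h) (c + d) := by
  simpa [ConvergesTo] using Tendsto.add hg hh

lemma ConvergesTo.sub {g h : PowerSeries ℝ} {c d : ℝ} (hg : ConvergesTo g c)
    (hh : ConvergesTo h d) : ConvergesTo (g - h) (c - d) := by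
  simpa [ConvergesTo] using Tendsto.sub hg hh

lemma ConvergesTo.C_mul {g : PowerSeries ℝ} {c : ℝ} (hg : ConvergesTo g c) (a : ℝ) :
    ConvergesTo (PowerSeries.C a * g) (a * c) := by
  simpa [ConvergesTo] using Tendsto.const_mul a hg

lemma ConvergesTo.sum {ι : Type*} {s : Finset ι} {g : ι → PowerSeries ℝ} {c : ι → ℝ}
    (hg : ∀ i ∈ s, ConvergesTo (g i) (c i)) : ConvergesTo (∑ i ∈ s, g i) (∑ i ∈ s, c i) := by
  simpa [ConvergesTo] using tendsto_finsetSum s hg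

lemma ConvergesTo.X_mul_iff {g : PowerSeries ℝ} {c : ℝ} :
    ConvergesTo (PowerSeries.X * g) c ↔ ConvergesTo g c := by
  unfold ConvergesTo
  rw [← tendsto_add_atTop_iff_nat 1]
  simp only [PowerSeries.coeff_succ_X_mul]

lemma ConvergesTo.unique {g : PowerSeries ℝ} {c d : ℝ} (h : ConvergesTo g c)
    (h' : ConvergesTo g d) : c = d := tendsto_nhds_unique h h'

/-- As a signal, a constant series is an impulse at time zero. -/
lemma convergesTo_C (a : ℝ) : ConvergesTo (PowerSeries.C a) 0 := by
  refine Tendsto.congr' ?_ tendsto_const_nhds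
  filter_upwards [eventually_gt_atTop 0] with t ht
  rw [PowerSeries.coeff_C, if_neg ht.ne']

/-- The unit step. -/
def step : PowerSeries ℝ := PowerSeries.mk 1

lemma coeff_step (t : ℕ) : PowerSeries.coeff t step = 1 := by simp [step]

lemma step_mul_one_sub_X : step * (1 - PowerSeries.X) = 1 :=
  PowerSeries.mk_one_mul_one_sub_eq_one ℝ

lemma isRational_step : IsRational step := by
  refine IsRational.of_mul_eq_one (g := 1 - PowerSeries.X) ?_
    (by rw [mul_comm, step_mul_one_sub_X])
  exact rationalSubring.sub_mem rationalSubring.one_mem isRational_X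

lemma convergesTo_step : ConvergesTo step 1 := by
  simp [ConvergesTo, coeff_step]

/-- The response of a stable system to a vanishing input vanishes. -/
lemma convergesTo_zero_mul {s y : PowerSeries ℝ}
    (hs : Summable fun t => |PowerSeries.coeff t s|) (hy : ConvergesTo y 0) :
    ConvergesTo (s * y) 0 := by
  obtain ⟨B, hB⟩ := (Metric.isBounded_range_of_tendsto _ hy).exists_norm_le
  have hB' : ∀ t, ‖PowerSeries.coeff t y‖ ≤ B := fun t => hB _ ⟨t, rfl⟩
  have hB0 : 0 ≤ B := (norm_nonneg _).trans (hB' 0)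
  -- Tannery's theorem for the convolution, written as a sum over the lag `a` and dominated by `|s
  -- a| * B`.
  have key := tendsto_tsum_of_dominated_convergence (𝓕 := atTop)
    (f := fun (t a : ℕ) =>
      if a ≤ t then PowerSeries.coeff a s * PowerSeries.coeff (t - a) y else 0)
    (g := fun _ => (0 : ℝ)) (hs.mul_right B)
    (fun a => by
      have h1 : Tendsto (fun t => PowerSeries.coeff a s * PowerSeries.coeff (t - a) y) atTop
          (𝓝 (PowerSeries.coeff a s * 0)) :=
        Tendsto.const_mul _ (Tendsto.comp (g := fun t => PowerSeries.coeff t y) hy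
          (tendsto_sub_atTop_nat a))
      rw [mul_zero] at h1
      refine h1.congr' ?_
      filter_upwards [eventually_ge_atTop a] with t ht
      rw [if_pos ht])
    (Eventually.of_forall fun t a => by
      split_ifs
      · rw [norm_mul]
        exact mul_le_mul_of_nonneg_left (hB' _) (norm_nonneg _)
      · rw [norm_zero]; positivity)
  rw [tsum_zero] at key
  refine key.congr fun t => ?_
  rw [PowerSeries.coeff_mul, Finset.Nat.sum_antidiagonal_eq_sum_range_succ
    (fun i j => PowerSeries.coeff i s * PowerSeries.coeff j y),
    tsum_eq_sum (s := Finset.range (t + 1))]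
  · exact Finset.sum_congr rfl fun a ha => if_pos (Nat.lt_succ_iff.1 (Finset.mem_range.1 ha))
  · intro a ha
    exact if_neg fun h => ha (Finset.mem_range.2 (Nat.lt_succ_of_le h))

/-- A convergent rational impulse response is an integrator plus a stable system. -/
lemma IsRational.summable_sub {h : PowerSeries ℝ} {k : ℝ} (hh : IsRational h)
    (hk : ConvergesTo h k) :
    Summable fun t => |PowerSeries.coeff t (h - PowerSeries.C k * step)| := by
  refine IsRational.summable_abs (hh.sub ((isRational_C k).mul isRational_step)) ?_
  simpa [ConvergesTo] using hk.sub (convergesTo_step.C_mul k)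

/-! ### The sign of the integrator gain -/

lemma summable_abs_mul_pow {g : PowerSeries ℝ} {c : ℝ} (hg : ConvergesTo g c) {x : ℝ}
    (hx0 : 0 ≤ x) (hx1 : x < 1) : Summable fun t => ‖PowerSeries.coeff t g * x ^ t‖ := by
  obtain ⟨B, hB⟩ := (Metric.isBounded_range_of_tendsto _ hg).exists_norm_le
  refine ((summable_geometric_of_lt_one hx0 hx1).mul_left B).of_nonneg_of_le
    (fun _ => norm_nonneg _) fun t => ?_
  rw [norm_mul, norm_pow, Real.norm_of_nonneg hx0]
  exact mul_le_mul_of_nonneg_right (hB _ ⟨t, rfl⟩) (by positivity)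

/-- Convergent coefficients are bounded, so evaluation at `x` is absolutely convergent and a Cauchy
product applies. This allows loop equations to be evaluated at a point. -/
lemma tsum_mul_pow {g y : PowerSeries ℝ} {c d : ℝ} (hg : ConvergesTo g c) (hy : ConvergesTo y d)
    {x : ℝ} (hx0 : 0 ≤ x) (hx1 : x < 1) :
    ∑' t, PowerSeries.coeff t (g * y) * x ^ t =
      (∑' t, PowerSeries.coeff t g * x ^ t) * ∑' t, PowerSeries.coeff t y * x ^ t := by
  rw [tsum_mul_tsum_eq_tsum_sum_antidiagonal_of_summable_norm (summable_abs_mul_pow hg hx0 hx1)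
    (summable_abs_mul_pow hy hx0 hx1)]
  refine tsum_congr fun t => ?_
  rw [PowerSeries.coeff_mul, Finset.sum_mul]
  refine Finset.sum_congr rfl fun p hp => ?_
  rw [← Finset.HasAntidiagonal.mem_antidiagonal.1 hp, pow_add]
  ring

/-- For small `ε > 0` a system with positive integrator gain takes the value `1 / ε`
on `[0, 1)`. -/
lemma exists_mul_tsum_eq_one {h : PowerSeries ℝ} {k : ℝ} (hh : IsRational h)
    (hk : ConvergesTo h k) (hpos : 0 < k) {ε₀ : ℝ} (hε₀ : 0 < ε₀) :
    ∃ ε, 0 < ε ∧ ε < ε₀ ∧ ∃ x, 0 ≤ x ∧ x < 1 ∧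
      ε * ∑' t, PowerSeries.coeff t h * x ^ t = 1 := by
  set s := h - PowerSeries.C k * step
  have hs : Summable fun t => |PowerSeries.coeff t s| := hh.summable_sub hk
  set S : ℝ → ℝ := fun x => ∑' t, PowerSeries.coeff t s * x ^ t
  have hS : ContinuousOn S (Set.Icc 0 1) := by
    refine continuousOn_tsum (fun t => by fun_prop) hs fun t x hx => ?_
    rw [norm_mul, norm_pow, Real.norm_of_nonneg hx.1]
    exact mul_le_of_le_one_right (norm_nonneg _) (pow_le_one₀ hx.1 hx.2)
  -- `k + S 0` is the value of the series at `0`; `ε ≤ 1 / B` keeps `ε` times it below 1.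
  set B := |k + S 0| + 1
  have hB : 0 < B := by positivity
  set ε := min (ε₀ / 2) (1 / B)
  have hε : 0 < ε := lt_min (by positivity) (by positivity)
  have h0 : 0 ≤ (1 - (0 : ℝ)) - ε * (k + (1 - 0) * S 0) := by
    have h1 : ε * (k + S 0) ≤ ε * B :=
      mul_le_mul_of_nonneg_left ((le_abs_self _).trans (by simp [B])) hε.le
    have h2 : ε * B ≤ 1 := by
      calc ε * B ≤ 1 / B * B := mul_le_mul_of_nonneg_right (min_le_right _ _) hB.le
        _ = 1 := by field_simp
    linarith
  have h1 : (1 - (1 : ℝ)) - ε * (k + (1 - 1) * S 1) ≤ 0 := by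
    have := mul_pos hε hpos
    linarith
  -- The equation `ε (k / (1 - x) + S x) = 1` multiplied by `1 - x`, which makes it continuous up to
  -- `x = 1`.
  obtain ⟨x, hx, hx'⟩ := intermediate_value_Icc' zero_le_one
    (f := fun x => (1 - x) - ε * (k + (1 - x) * S x)) (by fun_prop) ⟨h1, h0⟩
  have hx1 : x < 1 := by
    refine lt_of_le_of_ne hx.2 ?_
    rintro rfl
    have := mul_pos hε hpos
    simp only at hx'
    linarith
  refine ⟨ε, hε, (min_le_left _ _).trans_lt (by linarith), x, hx.1, hx1, ?_⟩
  have hsum : ∑' t, PowerSeries.coeff t h * x ^ t = k * (1 - x)⁻¹ + S x := by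
    rw [← tsum_geometric_of_lt_one hx.1 hx1, ← tsum_mul_left, ← Summable.tsum_add]
    · refine tsum_congr fun t => ?_
      simp only [s, map_sub, PowerSeries.coeff_C_mul, coeff_step]
      ring
    · exact (summable_geometric_of_lt_one hx.1 hx1).mul_left k
    · have hs0 : ConvergesTo s (k - k * 1) := hk.sub (convergesTo_step.C_mul k)
      exact (summable_abs_mul_pow hs0 hx.1 hx1).of_norm
  have hne : 1 - x ≠ 0 := by linarith
  rw [hsum]
  simp only at hx'
  field_simp
  linarith

/-- If the loop with `(ε/2) (y - 1)²` converges to the minimizer for all small `ε > 0`, then the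
integrator gain is negative. -/
lemma integrator_gain_neg {h : PowerSeries ℝ} {k : ℝ} (hh : IsRational h)
    (hk : ConvergesTo h k) {ε₀ : ℝ} (hε₀ : 0 < ε₀)
    (hloop : ∀ ε, 0 < ε → ε < ε₀ → ∃ y : PowerSeries ℝ, ConvergesTo y 1 ∧
      y = h * (PowerSeries.C ε * (y - step))) : k < 0 := by
  have hsub : ∀ {y}, ConvergesTo y 1 → ConvergesTo (y - step) 0 := fun hy => by
    simpa using hy.sub convergesTo_step
  rcases lt_trichotomy k 0 with hneg | rfl | hpos
  · exact hneg
  · obtain ⟨y, hy, hyl⟩ := hloop (ε₀ / 2) (by linarith) (by linarith)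
    have h1 : ConvergesTo y 0 := by
      rw [hyl]
      refine convergesTo_zero_mul (hh.summable_abs hk) ?_
      simpa using (hsub hy).C_mul (ε₀ / 2)
    exact absurd (hy.unique h1) one_ne_zero
  · obtain ⟨ε, hε, hε', x, hx0, hx1, hx⟩ := exists_mul_tsum_eq_one hh hk hpos hε₀
    obtain ⟨y, hy, hyl⟩ := hloop ε hε hε'
    have h1 : y = PowerSeries.C ε * (h * (y - step)) := by
      conv_lhs => rw [hyl]
      ring
    -- At this `x` the loop equation reads `Y(x) = Y(x) - 1 / (1 - x)`.
    have h2 := congrArg (fun g => ∑' t, PowerSeries.coeff t g * x ^ t) h1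
    simp only [PowerSeries.coeff_C_mul, mul_assoc ε, tsum_mul_left] at h2
    rw [tsum_mul_pow hk (hsub hy) hx0 hx1, ← mul_assoc, hx, one_mul] at h2
    simp only [map_sub, coeff_step, sub_mul, one_mul] at h2
    rw [Summable.tsum_sub (summable_abs_mul_pow hy hx0 hx1).of_norm
      (summable_geometric_of_lt_one hx0 hx1), tsum_geometric_of_lt_one hx0 hx1] at h2
    have : 0 < (1 - x)⁻¹ := inv_pos.2 (by linarith)
    linarith

/-! ### Networks and their closed loops -/

lemma laplacian_balanced {n : ℕ} {A : Matrix (Fin n) (Fin n) ℝ} (h : IsBalanced (laplacian A))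
    (j : Fin n) : ∑ i, laplacian A i j = 0 := by
  simpa [Matrix.mulVec, dotProduct] using congrFun h j

lemma laplacian_apply_sum {n : ℕ} {R : Type*} [CommRing R] (f : ℝ →+* R)
    (A : Matrix (Fin n) (Fin n) ℝ) (i : Fin n) (x : Fin n → R) :
    ∑ j, f (laplacian A i j) * x j = ∑ j, f (A i j) * (x i - x j) := by
  simp only [laplacian, Matrix.sub_apply, map_sub, sub_mul, mul_sub, Finset.sum_sub_distrib]
  congr 1
  simp [Matrix.diagonal_apply, Matrix.mulVec, dotProduct, Finset.sum_mul, map_sum, ite_mul, apply_ite f]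

/-- There are connected balanced networks with arbitrarily small Laplacian. -/
lemma exists_network {n : ℕ} (hn : 0 < n) {δ : ℝ} (hδ : 0 < δ) :
    ∃ A : Matrix (Fin n) (Fin n) ℝ, IsConnectedNetwork A ∧ IsBalanced (laplacian A) ∧
      SpectralRadiusLT (laplacian A) δ := by
  let _ : NormedRing (Matrix (Fin n) (Fin n) ℂ) := Matrix.linftyOpNormedRing
  let _ : NormedAlgebra ℂ (Matrix (Fin n) (Fin n) ℂ) := Matrix.linftyOpNormedAlgebra
  have : Nonempty (Fin n) := ⟨⟨0, hn⟩⟩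
  have : NormOneClass (Matrix (Fin n) (Fin n) ℂ) := Matrix.linfty_opNormOneClass
  have : CompleteSpace (Matrix (Fin n) (Fin n) ℂ) := FiniteDimensional.complete ℂ _
  set B := toComplex (laplacian (Matrix.of fun _ _ : Fin n => (1 : ℝ)))
  -- The complete graph with uniform weight `s`: the spectral radius is at most `s * ‖B‖ < δ`.
  set s := δ / (2 * (‖B‖ + 1))
  have hs : 0 < s := by positivity
  have hL : toComplex (laplacian (Matrix.of fun _ _ : Fin n => s)) = (s : ℂ) • B := by
    ext i j
    simp [B, toComplex, laplacian, Matrix.diagonal_apply, Matrix.mulVec, dotProduct]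
    split_ifs
    · simp
      ring
    · simp
  refine ⟨Matrix.of fun _ _ => s, ⟨fun _ _ => hs.le, fun i j =>
    Relation.ReflTransGen.single hs.ne'⟩, ?_, ?_⟩
  · ext j
    simp [laplacian, Matrix.mulVec, dotProduct, Matrix.diagonal_apply, Finset.sum_sub_distrib]
  · unfold SpectralRadiusLT
    rw [hL]
    refine (spectrum.spectralRadius_le_nnnorm _).trans_lt ?_
    rw [← ENNReal.ofReal_coe_nnreal, ENNReal.ofReal_lt_ofReal_iff hδ, coe_nnnorm, norm_smul,
      Complex.norm_real, Real.norm_of_nonneg hs.le]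
    have : 0 ≤ ‖B‖ := norm_nonneg _
    simp only [s]
    rw [div_mul_eq_mul_div, div_lt_iff₀ (by positivity)]
    nlinarith

lemma response_eq_coeff (g : PowerSeries ℝ) (u : ℕ → ℝ) (t : ℕ) :
    response g u t = PowerSeries.coeff t (g * PowerSeries.mk u) := by
  simp [response, PowerSeries.coeff_mul]

/-- The equations of the network loop, with the signals written as series. -/
def SeriesLoop {n m : ℕ} (G : AgentSystem m) (L : Matrix (Fin n) (Fin n) ℝ)
    (U : Fin n → PowerSeries ℝ) (V : Fin n → Fin m → PowerSeries ℝ)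
    (Y : Fin n → PowerSeries ℝ) (Z : Fin n → Fin m → PowerSeries ℝ) : Prop :=
  (∀ i, Y i = G (Sum.inl ()) (Sum.inl ()) * U i + ∑ k, G (Sum.inl ()) (Sum.inr k) * V i k) ∧
  (∀ i k, Z i k = G (Sum.inr k) (Sum.inl ()) * U i + ∑ l, G (Sum.inr k) (Sum.inr l) * V i l) ∧
  ∀ i k, V i k = ∑ j, PowerSeries.C (L i j) * Z j k

/-- Convolution is the product of series, so the loop becomes a linear system over the power series
ring. -/
lemma networkLoop_iff {n m : ℕ} {G : AgentSystem m} {A : Matrix (Fin n) (Fin n) ℝ}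
    {u : Fin n → ℕ → ℝ} {v : Fin n → Fin m → ℕ → ℝ} {y : Fin n → ℕ → ℝ}
    {z : Fin n → Fin m → ℕ → ℝ} :
    NetworkLoop G A u v y z ↔
      SeriesLoop G (laplacian A) (fun i => PowerSeries.mk (u i))
        (fun i k => PowerSeries.mk (v i k)) (fun i => PowerSeries.mk (y i))
        (fun i k => PowerSeries.mk (z i k)) := by
  have h3 : ∀ i k t, PowerSeries.coeff t
      (∑ j, PowerSeries.C (laplacian A i j) * PowerSeries.mk (z j k)) =
        ∑ j, A i j * (z i k t - z j k t) := by
    intro i k t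
    simpa using laplacian_apply_sum (RingHom.id ℝ) A i (fun j => z j k t)
  unfold NetworkLoop SeriesLoop
  constructor
  · rintro ⟨h1, h2⟩
    refine ⟨fun i => ?_, fun i k => ?_, fun i k => ?_⟩
    · ext t
      simpa [mresponse, response_eq_coeff] using congrFun (congrFun (h1 i) (Sum.inl ())) t
    · ext t
      simpa [mresponse, response_eq_coeff] using congrFun (congrFun (h1 i) (Sum.inr k)) t
    · ext t
      rw [h3, PowerSeries.coeff_mk, h2]
  · rintro ⟨h1, h2, h4⟩
    refine ⟨fun i => ?_, fun i k t => ?_⟩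
    · ext x t
      rcases x with _ | k
      · simpa [mresponse, response_eq_coeff] using congrArg (PowerSeries.coeff t) (h1 i)
      · simpa [mresponse, response_eq_coeff] using congrArg (PowerSeries.coeff t) (h2 i k)
    · rw [← h3, ← h4, PowerSeries.coeff_mk]

/-- The closed loop of a network is well posed, with a rational transfer matrix. -/
lemma exists_closedLoop {n m : ℕ} (G : AgentSystem m) (hG : MIsRational G)
    (h22 : MStrictlyCausal G.toBlocks₂₂) (L : Matrix (Fin n) (Fin n) ℝ) :
    ∃ Q : Matrix (Fin n) (Fin n) (PowerSeries ℝ), MIsRational Q ∧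
      (∀ U V Y Z, SeriesLoop G L U V Y Z → Y = Q.mulVec U) ∧
      ∀ U, ∃ V Y Z, SeriesLoop G L U V Y Z := by
  -- Eliminating `Z` leaves `V = K V + B U`, and `D` feeds `V` to the outputs. Strict causality of
  -- the 22 block kills the constant term of `K`, so `1 - K` is invertible.
  let K : Matrix (Fin n × Fin m) (Fin n × Fin m) (PowerSeries ℝ) := Matrix.of fun p r =>
    PowerSeries.C (L p.1 r.1) * G (Sum.inr p.2) (Sum.inr r.2)
  let B : Matrix (Fin n × Fin m) (Fin n) (PowerSeries ℝ) := Matrix.of fun p j =>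
    PowerSeries.C (L p.1 j) * G (Sum.inr p.2) (Sum.inl ())
  let D : Matrix (Fin n) (Fin n × Fin m) (PowerSeries ℝ) := Matrix.of fun i p =>
    if i = p.1 then G (Sum.inl ()) (Sum.inr p.2) else 0
  have hone : ∀ {ι : Type} [DecidableEq ι] (i j : ι),
      (1 : Matrix ι ι (PowerSeries ℝ)) i j ∈ rationalSubring := by
    intro ι _ i j
    rw [Matrix.one_apply]
    split_ifs
    exacts [one_mem _, zero_mem _]
  obtain ⟨M', hM', hMM', hM'M⟩ := exists_rational_inverse (1 - K)
    (fun p r => (hone p r : IsRational _).sub ((isRational_C _).mul (hG _ _))) (by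
      ext p r
      have h : PowerSeries.constantCoeff (G (Sum.inr p.2) (Sum.inr r.2)) = 0 := h22 p.2 r.2
      simp [K, h, Matrix.one_apply, apply_ite PowerSeries.constantCoeff])
  have hV : ∀ (U : Fin n → PowerSeries ℝ) (V Z : Fin n → Fin m → PowerSeries ℝ),
      (∀ i k, Z i k = G (Sum.inr k) (Sum.inl ()) * U i +
        ∑ l, G (Sum.inr k) (Sum.inr l) * V i l) → ∀ i k,
      ∑ j, PowerSeries.C (L i j) * Z j k = (K.mulVec (fun p => V p.1 p.2) + B.mulVec U) (i, k) := by
    intro U V Z hZ i k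
    simp only [hZ, Pi.add_apply, Matrix.mulVec, dotProduct, Fintype.sum_prod_type, K, B,
      Matrix.of_apply, mul_add, Finset.sum_add_distrib, Finset.mul_sum, mul_assoc]
    rw [add_comm]
  refine ⟨G (Sum.inl ()) (Sum.inl ()) • 1 + D * (M' * B), fun i j => ?_, ?_, fun U => ?_⟩
  · refine rationalSubring.add_mem (rationalSubring.mul_mem (hG _ _) (hone i j))
      (rationalSubring.sum_mem fun p _ => rationalSubring.mul_mem ?_
        (rationalSubring.sum_mem fun r _ => rationalSubring.mul_mem (hM' _ _)
          ((isRational_C _).mul (hG _ _))))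
    simp only [D, Matrix.of_apply]
    split_ifs
    exacts [hG _ _, zero_mem _]
  · rintro U V Y Z ⟨hY, hZ, hVZ⟩
    have h1 : (1 - K).mulVec (fun p => V p.1 p.2) = B.mulVec U := by
      ext1 p
      have := hV U V Z hZ p.1 p.2
      rw [← hVZ] at this
      rw [Matrix.sub_mulVec, Matrix.one_mulVec, Pi.sub_apply, this, Pi.add_apply]
      simp
    have h2 : (fun p : Fin n × Fin m => V p.1 p.2) = M'.mulVec (B.mulVec U) := by
      rw [← h1, Matrix.mulVec_mulVec, hM'M, Matrix.one_mulVec]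
    ext1 i
    rw [Matrix.add_mulVec, Matrix.smul_mulVec, Matrix.one_mulVec, ← Matrix.mulVec_mulVec,
      ← Matrix.mulVec_mulVec, ← h2, hY]
    simp [D, Matrix.mulVec, dotProduct, Fintype.sum_prod_type, Finset.sum_ite_irrel]
  · set V := fun i k => M'.mulVec (B.mulVec U) (i, k)
    refine ⟨V, _, _, fun i => rfl, fun i k => rfl, fun i k => ?_⟩
    rw [hV U V _ fun _ _ => rfl]
    have h1 : (1 - K).mulVec (M'.mulVec (B.mulVec U)) = B.mulVec U := by
      rw [Matrix.mulVec_mulVec, hMM', Matrix.one_mulVec]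
    rw [Matrix.sub_mulVec, Matrix.one_mulVec] at h1
    exact congrFun (sub_eq_iff_eq_add'.1 h1) (i, k)

/-- Over a balanced network, the mean output is the response of the agent to the mean input. -/
lemma SeriesLoop.sum_output {n m : ℕ} {G : AgentSystem m} {L : Matrix (Fin n) (Fin n) ℝ}
    (hL : ∀ j, ∑ i, L i j = 0) {U V Y Z} (h : SeriesLoop G L U V Y Z) :
    ∑ i, Y i = G (Sum.inl ()) (Sum.inl ()) * ∑ i, U i := by
  obtain ⟨hY, -, hV⟩ := h
  have hV0 : ∀ k, ∑ i, V i k = 0 := by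
    intro k
    simp only [hV]
    rw [Finset.sum_comm]
    refine Finset.sum_eq_zero fun j _ => ?_
    rw [← Finset.sum_mul, ← map_sum, hL, map_zero, zero_mul]
  simp only [hY, Finset.sum_add_distrib, ← Finset.mul_sum]
  rw [Finset.sum_comm]
  simp [← Finset.mul_sum, hV0]

/-! ### The closed loop of a distributed optimization algorithm -/

lemma deriv_quad (ε ystar x : ℝ) : deriv (quad ε ystar) x = ε * (x - ystar) := by
  have h : HasDerivAt (quad ε ystar) (ε / 2 * (2 * (x - ystar) ^ 1 * 1)) x :=
    (((hasDerivAt_id x).sub_const ystar).pow 2).const_mul (ε / 2)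
  rw [h.deriv]
  ring

lemma isTransient_zero : IsTransient fun _ => 0 := Eventually.of_forall fun _ => rfl

lemma mk_coeff (g : PowerSeries ℝ) : PowerSeries.mk (fun t => PowerSeries.coeff t g) = g := by
  ext t; simp

/-- What the definition of a distributed optimization algorithm says about one network with closed
loop `Q`. -/
structure IsOptimizingLoop {n : ℕ} (h : PowerSeries ℝ)
    (Q : Matrix (Fin n) (Fin n) (PowerSeries ℝ)) : Prop where
  rational : MIsRational Q
  sum_col : ∀ j, ∑ i, Q i j = h
  impulse : ∀ j, ∃ c, ∀ i, ConvergesTo (Q i j) c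
  quadratic : ∃ ε₀ > 0, ∀ ε : ℝ, 0 < ε → ε < ε₀ → ∀ ystar : Fin n → ℝ,
    ∃ Y : Fin n → PowerSeries ℝ,
      Y = Q.mulVec (fun i => PowerSeries.C ε * (Y i - PowerSeries.C (ystar i) * step)) ∧
      ∀ i, ConvergesTo (Y i) ((1 / (n : ℝ)) * ∑ j, ystar j)

/-- Column `j` of `Q` is the response to a unit impulse at agent `j`, and an impulse is a transient;
so the case of zero objectives controls the columns. -/
lemma IsDistributedOptimizationAlgorithm.exists_isOptimizingLoop {n m : ℕ} {H : AgentSystem m}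
    (hrat : MIsRational H) (h22 : MStrictlyCausal H.toBlocks₂₂)
    (hH : IsDistributedOptimizationAlgorithm n H) :
    ∃ δ > 0, ∀ A : Matrix (Fin n) (Fin n) ℝ, IsConnectedNetwork A → IsBalanced (laplacian A) →
      SpectralRadiusLT (laplacian A) δ →
      ∃ Q, IsOptimizingLoop (H (Sum.inl ()) (Sum.inl ())) Q ∧
        ∀ U V Y Z, SeriesLoop H (laplacian A) U V Y Z → Y = Q.mulVec U := by
  obtain ⟨δ, hδ, hA⟩ := hH
  refine ⟨δ, hδ, fun A hc hb hs => ?_⟩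
  obtain ⟨⟨ε₀, hε₀, hquad⟩, hzero⟩ := hA A hc hb hs
  obtain ⟨Q, hQ, hloop, hex⟩ := exists_closedLoop H hrat h22 (laplacian A)
  have hcol : ∀ j, Q.mulVec (Pi.single j 1) = fun i => Q i j := fun j => by
    ext1 i; simp
  refine ⟨Q, ⟨hQ, fun j => ?_, fun j => ?_, ε₀, hε₀, fun ε h0 h1 ystar => ?_⟩, hloop⟩
  · obtain ⟨V, Y, Z, h⟩ := hex (Pi.single j 1)
    have := h.sum_output (laplacian_balanced hb)
    rw [hloop _ _ _ _ h, hcol] at this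
    simpa using this
  · obtain ⟨V, Y, Z, h⟩ := hex (Pi.single j 1)
    obtain ⟨c, hc⟩ := hzero
      (fun i t => PowerSeries.coeff t ((Pi.single j 1 : Fin n → PowerSeries ℝ) i))
      (fun i => by
        filter_upwards [eventually_gt_atTop 0] with t ht
        by_cases hij : i = j
        · subst hij; simp [PowerSeries.coeff_one, ht.ne']
        · simp [hij])
      (fun i t => PowerSeries.coeff t ((Pi.single j 1 : Fin n → PowerSeries ℝ) i))
      (fun i k t => PowerSeries.coeff t (V i k)) (fun i t => PowerSeries.coeff t (Y i))
      (fun i k t => PowerSeries.coeff t (Z i k))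
      ⟨networkLoop_iff.2 (by simpa only [mk_coeff] using h), fun i t => by simp⟩
    refine ⟨c, fun i => ?_⟩
    have := hc i
    rw [hloop _ _ _ _ h, hcol] at this
    exact this
  · obtain ⟨⟨u, v, y, z, h⟩, hlim⟩ := hquad ε h0 h1 ystar (fun _ _ => 0) fun _ => isTransient_zero
    refine ⟨fun i => PowerSeries.mk (y i), ?_, fun i => ?_⟩
    · rw [hloop _ _ _ _ (networkLoop_iff.1 h.1)]
      congr 1
      ext i t
      rw [← hloop _ _ _ _ (networkLoop_iff.1 h.1)]
      simp [h.2, deriv_quad, coeff_step]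
    · simpa [ConvergesTo] using hlim _ _ _ _ h i

namespace IsOptimizingLoop

variable {n : ℕ} {h : PowerSeries ℝ} {Q : Matrix (Fin n) (Fin n) (PowerSeries ℝ)}

lemma sum_mulVec (hQ : IsOptimizingLoop h Q) (U : Fin n → PowerSeries ℝ) :
    ∑ i, Q.mulVec U i = h * ∑ i, U i := by
  simp only [Matrix.mulVec, dotProduct]
  rw [Finset.sum_comm, Finset.mul_sum]
  simp only [← Finset.sum_mul, hQ.sum_col]

lemma exists_gain (hQ : IsOptimizingLoop h Q) (hn : 0 < n) : ∃ k, ConvergesTo h k := by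
  obtain ⟨c, hc⟩ := hQ.impulse ⟨0, hn⟩
  exact ⟨_, hQ.sum_col ⟨0, hn⟩ ▸ ConvergesTo.sum fun i _ => hc i⟩

lemma convergesTo_apply (hQ : IsOptimizingLoop h Q) {k : ℝ} (hk : ConvergesTo h k) (i j : Fin n) :
    ConvergesTo (Q i j) (k / n) := by
  have hn : 0 < n := i.pos
  obtain ⟨c, hc⟩ := hQ.impulse j
  have h1 : ConvergesTo h (∑ i : Fin n, c) := hQ.sum_col j ▸ ConvergesTo.sum fun i _ => hc i
  have h2 : k = n * c := by simpa using hk.unique h1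
  have h3 : k / n = c := by rw [h2]; field_simp
  exact h3 ▸ hc i

/-- With all targets equal to 1, the mean output obeys the scalar loop of `h`. -/
lemma gain_neg (hQ : IsOptimizingLoop h Q) (hn : 0 < n) (hh : IsRational h) {k : ℝ}
    (hk : ConvergesTo h k) : k < 0 := by
  obtain ⟨ε₀, hε₀, hquad⟩ := hQ.quadratic
  refine integrator_gain_neg hh hk hε₀ fun ε h0 h1 => ?_
  obtain ⟨Y, hY, hlim⟩ := hquad ε h0 h1 fun _ => 1
  have hn' : (n : ℝ) ≠ 0 := by positivity
  refine ⟨PowerSeries.C (1 / (n : ℝ)) * ∑ i, Y i, ?_, ?_⟩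
  · have := (ConvergesTo.sum fun i (_ : i ∈ Finset.univ) => hlim i).C_mul (1 / (n : ℝ))
    simpa [hn'] using this
  · have hC : PowerSeries.C (1 / (n : ℝ)) * (n : PowerSeries ℝ) = 1 := by
      rw [← map_natCast (PowerSeries.C (R := ℝ)), ← map_mul, one_div_mul_cancel hn', map_one]
    conv_lhs => rw [hY, hQ.sum_mulVec]
    simp only [← Finset.mul_sum, Finset.sum_sub_distrib, map_one, one_mul, Finset.sum_const,
      Finset.card_univ, Fintype.card_fin, nsmul_eq_mul]
    linear_combination (-h * PowerSeries.C ε * step) * hC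

/-- Constant disagreement between the agents is blocked by the closed loop. -/
lemma convergesTo_mulVec_step (hQ : IsOptimizingLoop h Q) {k : ℝ}
    (hk : ConvergesTo h k) (hk0 : k ≠ 0) {b : Fin n → ℝ} (hb : ∑ i, b i = 0) (i : Fin n) :
    ConvergesTo (Q.mulVec (fun j => PowerSeries.C (b j) * step) i) 0 := by
  obtain ⟨ε₀, hε₀, hquad⟩ := hQ.quadratic
  obtain ⟨Y, hY, hlim⟩ := hquad (ε₀ / 2) (by linarith) (by linarith) b
  set ε := ε₀ / 2
  have hε : ε ≠ 0 := by simp only [ε]; positivity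
  have hsb : ∑ j, PowerSeries.C (b j) * step = 0 := by
    rw [← Finset.sum_mul, ← map_sum, hb, map_zero, zero_mul]
  have hsum : ∑ j, Y j = 0 := by
    have h1 : ∑ j, Y j = h * (PowerSeries.C ε * ∑ j, Y j) := by
      conv_lhs => rw [hY, hQ.sum_mulVec]
      rw [← Finset.mul_sum, Finset.sum_sub_distrib, hsb, sub_zero]
    have h2 : (1 - PowerSeries.C ε * h) * ∑ j, Y j = 0 := by linear_combination h1
    -- Otherwise `ε h` would be an impulse, with limit 0 instead of `ε k`.
    refine (mul_eq_zero.1 h2).resolve_left fun h3 => ?_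
    have h4 : ConvergesTo (PowerSeries.C ε * h) 0 := by
      rw [← sub_eq_zero.1 h3]
      simpa using convergesTo_C 1
    exact mul_ne_zero hε hk0 ((hk.C_mul ε).unique h4)
  have hY0 : ∀ j, ConvergesTo (Y j) 0 := fun j => by simpa [hb] using hlim j
  have hQY : ConvergesTo (Q.mulVec Y i) 0 := by
    -- Since the outputs sum to zero exactly, the common integrator part of `Q` can be subtracted,
    -- leaving stable entries.
    have h1 : Q.mulVec Y i =
        ∑ j, (Q i j - PowerSeries.C (k / n) * step) * Y j := by
      simp only [sub_mul, Finset.sum_sub_distrib, ← Finset.mul_sum, hsum, mul_zero, sub_zero]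
      rfl
    rw [h1]
    simpa using ConvergesTo.sum fun j (_ : j ∈ Finset.univ) => convergesTo_zero_mul
      ((hQ.rational i j).summable_sub (hQ.convergesTo_apply hk i j)) (hY0 j)
  have hU : (fun j => PowerSeries.C (b j) * step) = Y - PowerSeries.C ε⁻¹ •
      (fun j => PowerSeries.C ε * (Y j - PowerSeries.C (b j) * step)) := by
    ext1 j
    have hC : PowerSeries.C ε⁻¹ * PowerSeries.C ε = 1 := by
      rw [← map_mul, inv_mul_cancel₀ hε, map_one]
    simp only [Pi.sub_apply, Pi.smul_apply, smul_eq_mul]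
    linear_combination (Y j - PowerSeries.C (b j) * step) * hC
  rw [hU, Matrix.mulVec_sub, Matrix.mulVec_smul, ← hY]
  simpa using hQY.sub ((hY0 i).C_mul ε⁻¹)

/-- The response of the closed loop to differences of ramps with constant mean. -/
lemma convergesTo_mulVec (hQ : IsOptimizingLoop h Q) {k : ℝ}
    (hk : ConvergesTo h k) (hk0 : k ≠ 0) (a : Fin n → ℝ) {b : Fin n → ℝ} (hb : ∑ i, b i = 0)
    (i : Fin n) :
    ConvergesTo (Q.mulVec (fun j => PowerSeries.C (a j) +
      PowerSeries.X * (PowerSeries.C (b j) * step)) i) (k * ((1 / (n : ℝ)) * ∑ j, a j)) := by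
  have h1 : ConvergesTo (Q.mulVec (fun j => PowerSeries.C (a j)) i)
      (k * ((1 / (n : ℝ)) * ∑ j, a j)) := by
    have := ConvergesTo.sum fun j (_ : j ∈ Finset.univ) =>
      (hQ.convergesTo_apply hk i j).C_mul (a j)
    rw [← Finset.sum_mul] at this
    convert this using 1
    · simp only [Matrix.mulVec, dotProduct, mul_comm (Q i _)]
    · ring
  have h2 := ConvergesTo.X_mul_iff.2 (hQ.convergesTo_mulVec_step hk hk0 hb i)
  have h3 := h1.add h2
  rw [add_zero] at h3
  convert h3 using 1
  rw [← smul_eq_mul PowerSeries.X, ← Pi.smul_apply PowerSeries.X (Q.mulVec _) i,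
    ← Matrix.mulVec_smul, ← Pi.add_apply, ← Matrix.mulVec_add]
  rfl

end IsOptimizingLoop

/-! ### The integrator as an optimization method -/

/-- The integrator with gain `k` and delay `p`. -/
def integrator (k : ℝ) (p : ℕ) : PowerSeries ℝ :=
  PowerSeries.C k * (PowerSeries.X ^ p * step)

lemma isRational_integrator (k : ℝ) (p : ℕ) : IsRational (integrator k p) :=
  (isRational_C k).mul (IsRational.mul (rationalSubring.pow_mem isRational_X p) isRational_step)

lemma coeff_integrator_zero (k : ℝ) (t : ℕ) :
    PowerSeries.coeff t (integrator k 0) = k := by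
  simp [integrator, coeff_step]

lemma one_sub_X_mul_integrator (k : ℝ) (p : ℕ) :
    (1 - PowerSeries.X) * integrator k p = PowerSeries.C k * PowerSeries.X ^ p := by
  unfold integrator
  linear_combination (PowerSeries.C k * PowerSeries.X ^ p) * step_mul_one_sub_X

lemma coeff_integrator_mul (k : ℝ) (p : ℕ) (u : PowerSeries ℝ) (t : ℕ) :
    PowerSeries.coeff (t + 1) (integrator k p * u) - PowerSeries.coeff t (integrator k p * u) =
      k * PowerSeries.coeff (t + 1) (PowerSeries.X ^ p * u) := by
  rw [← PowerSeries.coeff_C_mul, ← mul_assoc, ← one_sub_X_mul_integrator, mul_assoc, sub_mul,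
    one_mul, map_sub, PowerSeries.coeff_succ_X_mul]

lemma tendsto_of_eventually_contracting {z : ℕ → ℝ} {ρ : ℝ} (hρ : |ρ| < 1)
    (hz : ∀ᶠ t in atTop, z (t + 1) = ρ * z t) : Tendsto z atTop (𝓝 0) := by
  obtain ⟨T, hT⟩ := eventually_atTop.1 hz
  have h : ∀ t, z (t + T) = ρ ^ t * z T := by
    intro t
    induction t with
    | zero => simp
    | succ t ih => rw [add_right_comm, hT _ (Nat.le_add_left T t), ih]; ring
  rw [← tendsto_add_atTop_iff_nat T]
  simp only [h]
  simpa using (tendsto_pow_atTop_nhds_zero_of_abs_lt_one hρ).mul_const (z T)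

/-- The loop is solved by inverting `1 - ε G`. -/
lemma exists_optLoop {G : PowerSeries ℝ} {ε : ℝ} (hG : 1 - ε * PowerSeries.constantCoeff G ≠ 0)
    (ystar : ℝ) (e : ℕ → ℝ) : ∃ y u, OptLoop G (quad ε ystar) e y u := by
  have hu : IsUnit (1 - PowerSeries.C ε * G) := by
    rw [PowerSeries.isUnit_iff_constantCoeff]
    simpa using hG
  obtain ⟨R, hR⟩ := hu.exists_right_inv
  set E := PowerSeries.mk e
  set Y := R * (G * (E - PowerSeries.C (ε * ystar) * step))
  refine ⟨fun t => PowerSeries.coeff t Y,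
    fun t => PowerSeries.coeff t (PowerSeries.C ε * Y + (E - PowerSeries.C (ε * ystar) * step)),
    ?_, fun t => ?_⟩
  · ext t
    rw [response_eq_coeff, mk_coeff]
    congr 1
    simp only [Y]
    linear_combination (G * (E - PowerSeries.C (ε * ystar) * step)) * hR
  · simp only [map_add, map_sub, PowerSeries.coeff_C_mul, coeff_step, E, PowerSeries.coeff_mk,
      deriv_quad]
    ring

lemma OptLoop.sub_eq {k : ℝ} {p : ℕ} {f : ℝ → ℝ} {e y u : ℕ → ℝ}
    (h : OptLoop (integrator k p) f e y u) (t : ℕ) :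
    y (t + 1) - y t = k * PowerSeries.coeff (t + 1) (PowerSeries.X ^ p * PowerSeries.mk u) := by
  rw [← coeff_integrator_mul, h.1, response_eq_coeff, response_eq_coeff]

lemma exists_tendsto_of_eventually_eq {y : ℕ → ℝ} (h : ∀ᶠ t in atTop, y (t + 1) = y t) :
    ∃ c, Tendsto y atTop (𝓝 c) := by
  obtain ⟨T, hT⟩ := eventually_atTop.1 h
  refine ⟨y T, tendsto_const_nhds.congr' ?_⟩
  filter_upwards [eventually_ge_atTop T] with t ht
  induction t, ht using Nat.le_induction with
  | base => rfl
  | succ t ht ih => rw [hT t ht, ih]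

/-- Without delay this is the implicit gradient step: the error is divided by `1 - ε k > 1`, for
every `ε > 0`. -/
lemma isOptimizationMethod_integrator_zero {k : ℝ} (hk : k < 0) :
    IsOptimizationMethod (integrator k 0) := by
  refine ⟨⟨1, one_pos, fun ε h0 _ ystar e he => ?_⟩, fun e he y u h => ?_⟩
  · have hpos : 1 < 1 - ε * k := by nlinarith
    refine ⟨exists_optLoop ?_ ystar e, fun y u h => ?_⟩
    · rw [← PowerSeries.coeff_zero_eq_constantCoeff_apply, coeff_integrator_zero]
      linarith
    · have hz : Tendsto (fun t => y t - ystar) atTop (𝓝 0) := by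
        refine tendsto_of_eventually_contracting (ρ := (1 - ε * k)⁻¹) ?_ ?_
        · rw [abs_of_pos (inv_pos.2 (by linarith))]
          exact inv_lt_one_of_one_lt₀ hpos
        · filter_upwards [(tendsto_add_atTop_nat 1).eventually he] with t ht
          have h1 := h.sub_eq t
          simp only [pow_zero, one_mul, PowerSeries.coeff_mk, h.2, ht, deriv_quad] at h1
          rw [eq_inv_mul_iff_mul_eq₀ (by linarith)]
          linear_combination h1
      simpa using hz.add_const ystar
  · refine exists_tendsto_of_eventually_eq ?_
    filter_upwards [(tendsto_add_atTop_nat 1).eventually he] with t ht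
    have h1 := h.sub_eq t
    simp only [pow_zero, one_mul, PowerSeries.coeff_mk, h.2, ht, deriv_const] at h1
    linear_combination h1

lemma strictlyCausal_integrator_one (k : ℝ) : StrictlyCausal (integrator k 1) := by
  simp [StrictlyCausal, integrator]

/-- Explicit gradient descent: the error is multiplied by `1 + ε k`, which lies in `(0, 1)` for `ε <
1 / -k`. -/
lemma isOptimizationMethod_integrator_one {k : ℝ} (hk : k < 0) :
    IsOptimizationMethod (integrator k 1) := by
  have hk' : 0 < -k := by linarith
  refine ⟨⟨1 / -k, by positivity, fun ε h0 h1 ystar e he => ?_⟩, fun e he y u h => ?_⟩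
  · rw [lt_div_iff₀ hk'] at h1
    refine ⟨exists_optLoop ?_ ystar e, fun y u h => ?_⟩
    · rw [strictlyCausal_integrator_one k]
      simp
    · have hz : Tendsto (fun t => y t - ystar) atTop (𝓝 0) := by
        refine tendsto_of_eventually_contracting (ρ := 1 + ε * k) ?_ ?_
        · have := mul_pos h0 hk'
          rw [abs_lt]
          constructor <;> linarith
        · filter_upwards [he] with t ht
          have h1 := h.sub_eq t
          simp only [pow_one, PowerSeries.coeff_succ_X_mul, PowerSeries.coeff_mk, h.2, ht,
            deriv_quad] at h1
          linear_combination h1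
      simpa using hz.add_const ystar
  · refine exists_tendsto_of_eventually_eq ?_
    filter_upwards [he] with t ht
    have h1 := h.sub_eq t
    simp only [pow_one, PowerSeries.coeff_succ_X_mul, PowerSeries.coeff_mk, h.2, ht,
      deriv_const] at h1
    linear_combination h1

/-! ### The consensus estimator -/

lemma ConvergesTo.X_pow_mul_iff {g : PowerSeries ℝ} {c : ℝ} (p : ℕ) :
    ConvergesTo (PowerSeries.X ^ p * g) c ↔ ConvergesTo g c := by
  induction p with
  | zero => simp
  | succ p ih => rw [pow_succ', mul_assoc, ConvergesTo.X_mul_iff, ih]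

/-- The inverse of the undelayed integrator. -/
def differencer (k : ℝ) : PowerSeries ℝ := PowerSeries.C k⁻¹ * (1 - PowerSeries.X)

lemma isRational_differencer (k : ℝ) : IsRational (differencer k) :=
  (isRational_C _).mul (rationalSubring.sub_mem rationalSubring.one_mem isRational_X)

lemma differencer_mul_integrator {k : ℝ} (hk : k ≠ 0) (p : ℕ) :
    differencer k * integrator k p = PowerSeries.X ^ p := by
  rw [differencer, mul_assoc, one_sub_X_mul_integrator, ← mul_assoc, ← map_mul,
    inv_mul_cancel₀ hk, map_one, one_mul]

lemma one_sub_X_mul_mk_eval {w : Polynomial ℝ} (hw : w.degree < 2) :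
    (1 - PowerSeries.X) * PowerSeries.mk (fun t : ℕ => w.eval (t : ℝ)) =
      PowerSeries.C (w.eval 0) +
        PowerSeries.X * (PowerSeries.C (w.eval 1 - w.eval 0) * step) := by
  have hw1 : w.degree ≤ 1 := Order.le_of_lt_succ hw
  rw [Polynomial.eq_X_add_C_of_degree_le_one hw1]
  ext t
  rw [sub_mul, one_mul]
  cases t with
  | zero => simp
  | succ t =>
    simp [PowerSeries.coeff_succ_X_mul, coeff_step]
    ring

/-- Loops of two agent systems that differ by an input filter `r` and by filters of the output and
of the network variables correspond to each other. -/
lemma SeriesLoop.intertwine {n m : ℕ} {G H : AgentSystem m} {L : Matrix (Fin n) (Fin n) ℝ}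
    {U V Y Z} {r c d : PowerSeries ℝ} (h : SeriesLoop G L U V Y Z)
    (h11 : c * G (Sum.inl ()) (Sum.inl ()) = H (Sum.inl ()) (Sum.inl ()) * r)
    (h12 : ∀ l, c * G (Sum.inl ()) (Sum.inr l) = H (Sum.inl ()) (Sum.inr l) * d)
    (h21 : ∀ l, d * G (Sum.inr l) (Sum.inl ()) = H (Sum.inr l) (Sum.inl ()) * r)
    (h22 : ∀ l l', G (Sum.inr l) (Sum.inr l') = H (Sum.inr l) (Sum.inr l')) :
    SeriesLoop H L (fun i => r * U i) (fun i l => d * V i l) (fun i => c * Y i)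
      (fun i l => d * Z i l) := by
  obtain ⟨hY, hZ, hV⟩ := h
  refine ⟨fun i => ?_, fun i l => ?_, fun i l => ?_⟩
  · simp only [hY, mul_add, Finset.mul_sum, ← mul_assoc, h11, h12]
  · simp only [hZ, mul_add, Finset.mul_sum, ← mul_assoc, h21, h22, mul_comm d (H _ _)]
  · simp only [hV i l, Finset.mul_sum, mul_left_comm d]

/-- Replacing the input of a distributed optimization algorithm by its difference, up to delays of
the output and of the network variables, gives a consensus estimator of order two. -/
lemma isConsensusEstimator_of_intertwined {n m : ℕ} {H G : AgentSystem m}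
    (hrat : MIsRational H) (h22 : MStrictlyCausal H.toBlocks₂₂)
    (hH : IsDistributedOptimizationAlgorithm n H) (hG : MIsRational G)
    (hG22 : MStrictlyCausal G.toBlocks₂₂) {k : ℝ} (hk0 : k ≠ 0)
    (hk : ConvergesTo (H (Sum.inl ()) (Sum.inl ())) k) (c d : ℕ)
    (h11 : PowerSeries.X ^ c * G (Sum.inl ()) (Sum.inl ()) =
      H (Sum.inl ()) (Sum.inl ()) * differencer k)
    (h12 : ∀ l, PowerSeries.X ^ c * G (Sum.inl ()) (Sum.inr l) =
      H (Sum.inl ()) (Sum.inr l) * PowerSeries.X ^ d)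
    (h21 : ∀ l, PowerSeries.X ^ d * G (Sum.inr l) (Sum.inl ()) =
      H (Sum.inr l) (Sum.inl ()) * differencer k)
    (h22' : ∀ l l', G (Sum.inr l) (Sum.inr l') = H (Sum.inr l) (Sum.inr l')) :
    IsConsensusEstimator n 2 G := by
  obtain ⟨δ, hδ, hA⟩ := hH.exists_isOptimizingLoop hrat h22
  refine ⟨δ, hδ, fun A hc hb _ hs w wstar hw hmean => ⟨?_, fun v y z h i => ?_⟩⟩
  · obtain ⟨Q, -, -, hex⟩ := exists_closedLoop G hG hG22 (laplacian A)
    obtain ⟨V, Y, Z, h⟩ := hex fun i => PowerSeries.mk fun t => (w i).eval (t : ℝ)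
    exact ⟨fun i k t => PowerSeries.coeff t (V i k), fun i t => PowerSeries.coeff t (Y i),
      fun i k t => PowerSeries.coeff t (Z i k),
      networkLoop_iff.2 (by simpa only [mk_coeff] using h)⟩
  · obtain ⟨Q, hQ, hloop⟩ := hA A hc hb hs
    have hH' := (networkLoop_iff.1 h).intertwine h11 h12 h21 h22'
    have hn : (n : ℝ) ≠ 0 := Nat.cast_ne_zero.2 i.pos.ne'
    have hm0 := hmean 0
    have hm1 := hmean 1
    rw [Nat.cast_zero] at hm0
    rw [Nat.cast_one] at hm1
    -- The mean is the same at times 0 and 1, so the slopes sum to zero.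
    have hb0 : ∑ j, ((w j).eval 1 - (w j).eval 0) = 0 := by
      have h1 := hm1.trans hm0.symm
      rw [Finset.sum_sub_distrib, sub_eq_zero]
      exact mul_left_cancel₀ (one_div_ne_zero hn) h1
    have hlim := (hQ.convergesTo_mulVec hk hk0 (fun j => (w j).eval 0) hb0 i).C_mul k⁻¹
    have hU : (fun i => differencer k * PowerSeries.mk fun t : ℕ => (w i).eval (t : ℝ)) = PowerSeries.C k⁻¹ • fun j =>
        PowerSeries.C ((w j).eval 0) +
          PowerSeries.X * (PowerSeries.C ((w j).eval 1 - (w j).eval 0) * step) := by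
      ext1 j
      rw [differencer, mul_assoc, one_sub_X_mul_mk_eval (hw j)]
      rfl
    have hYi := congrFun (hloop _ _ _ _ hH') i
    rw [hU, Matrix.mulVec_smul, Pi.smul_apply, smul_eq_mul] at hYi
    -- The output delay does not change the limit, and `k⁻¹` cancels the gain.
    rw [← hYi, ConvergesTo.X_pow_mul_iff, hm0, inv_mul_cancel_left₀ hk0] at hlim
    simpa [ConvergesTo] using hlim

/-! ### The factorization -/

/-- The gain belongs to `H¹¹` alone, so one network of one size determines it and the same
integrator serves every `n`. -/
lemma exists_gain_neg {n m : ℕ} (hn : 0 < n) {H : AgentSystem m} (hrat : MIsRational H)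
    (h22 : MStrictlyCausal H.toBlocks₂₂) (hH : IsDistributedOptimizationAlgorithm n H) :
    ∃ k < 0, ConvergesTo (H (Sum.inl ()) (Sum.inl ())) k := by
  obtain ⟨δ, hδ, hA⟩ := hH.exists_isOptimizingLoop hrat h22
  obtain ⟨A, hc, hb, hs⟩ := exists_network hn hδ
  obtain ⟨Q, hQ, -⟩ := hA A hc hb hs
  obtain ⟨k, hk⟩ := hQ.exists_gain hn
  exact ⟨k, hQ.gain_neg hn (hrat _ _) hk, hk⟩

lemma mul_diagOne {m : ℕ} (G : AgentSystem m) (g : PowerSeries ℝ) :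
    G * diagOne m g = Matrix.fromBlocks (g • G.toBlocks₁₁) G.toBlocks₁₂ (g • G.toBlocks₂₁)
      G.toBlocks₂₂ := by
  have hg : (Matrix.of fun _ _ => g : Matrix Unit Unit (PowerSeries ℝ)) = g • 1 := by
    ext i j; simp
  conv_lhs => rw [← Matrix.fromBlocks_toBlocks G]
  rw [diagOne, hg, Matrix.fromBlocks_multiply]
  simp

lemma delayBlock_mul {m : ℕ} (q : ℕ) (G : AgentSystem m) :
    delayBlock m q * G = Matrix.fromBlocks G.toBlocks₁₁ G.toBlocks₁₂
      ((PowerSeries.X ^ q : PowerSeries ℝ) • G.toBlocks₂₁)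
      ((PowerSeries.X ^ q : PowerSeries ℝ) • G.toBlocks₂₂) := by
  conv_lhs => rw [← Matrix.fromBlocks_toBlocks G]
  rw [delayBlock, Matrix.fromBlocks_multiply]
  simp

lemma mul_delayBlock {m : ℕ} (q : ℕ) (G : AgentSystem m) :
    G * delayBlock m q = Matrix.fromBlocks G.toBlocks₁₁
      ((PowerSeries.X ^ q : PowerSeries ℝ) • G.toBlocks₁₂) G.toBlocks₂₁
      ((PowerSeries.X ^ q : PowerSeries ℝ) • G.toBlocks₂₂) := by
  conv_lhs => rw [← Matrix.fromBlocks_toBlocks G]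
  rw [delayBlock, Matrix.fromBlocks_multiply]
  simp

lemma MStrictlyCausal.exists_eq_X_smul {κ ι : Type*} {G : Matrix κ ι (PowerSeries ℝ)}
    (hG : MStrictlyCausal G) :
    ∃ F : Matrix κ ι (PowerSeries ℝ), G = (PowerSeries.X : PowerSeries ℝ) • F := by
  choose F hF using fun i j => PowerSeries.X_dvd_iff.2 (hG i j)
  exact ⟨Matrix.of F, by ext1 i j; exact hF i j⟩

lemma MIsRational.of_X_smul {κ ι : Type*} {F : Matrix κ ι (PowerSeries ℝ)}
    (hF : MIsRational ((PowerSeries.X : PowerSeries ℝ) • F)) : MIsRational F :=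
  fun i j => IsRational.of_X_mul (hF i j)

lemma MIsRational.smul {κ ι : Type*} {F : Matrix κ ι (PowerSeries ℝ)} {g : PowerSeries ℝ}
    (hg : IsRational g) (hF : MIsRational F) : MIsRational (g • F) :=
  fun i j => hg.mul (hF i j)

lemma MIsRational.fromBlocks {κ κ' ι ι' : Type*} {A : Matrix κ ι (PowerSeries ℝ)}
    {B : Matrix κ ι' (PowerSeries ℝ)} {C : Matrix κ' ι (PowerSeries ℝ)}
    {D : Matrix κ' ι' (PowerSeries ℝ)} (hA : MIsRational A) (hB : MIsRational B)
    (hC : MIsRational C) (hD : MIsRational D) : MIsRational (Matrix.fromBlocks A B C D) := by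
  rintro (i | i) (j | j)
  exacts [hA i j, hB i j, hC i j, hD i j]

/-- The feedthrough of `B * C` is a column times a row, which vanishes only if one factor does. -/
lemma mStrictlyCausal_of_mul {m : ℕ} {B : Matrix (Fin m) Unit (PowerSeries ℝ)}
    {C : Matrix Unit (Fin m) (PowerSeries ℝ)} (h : MStrictlyCausal (B * C))
    (hB : ¬ MStrictlyCausal B) : MStrictlyCausal C := by
  simp only [MStrictlyCausal, not_forall] at hB
  obtain ⟨i, u, hi⟩ := hB
  intro u' j
  have h1 : PowerSeries.constantCoeff ((B * C) i j) = 0 := h i j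
  rw [Matrix.mul_apply, Fintype.sum_unique, map_mul] at h1
  exact (mul_eq_zero.1 h1).resolve_left hi

end DistOpt

end

theorem theorem1 {m : ℕ} (N : Set ℕ) (hN : N.Nonempty) (hpos : ∀ n ∈ N, 0 < n)
    (H : DistOpt.AgentSystem m) (hrat : DistOpt.MIsRational H)
    (h22 : DistOpt.MStrictlyCausal H.toBlocks₂₂)
    (h2112 : DistOpt.MStrictlyCausal (H.toBlocks₂₁ * H.toBlocks₁₂))
    (hH : ∀ n ∈ N, DistOpt.IsDistributedOptimizationAlgorithm n H) :
    (∃ (Gopt : PowerSeries ℝ) (Gcon : DistOpt.AgentSystem m),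
      DistOpt.IsRational Gopt ∧ DistOpt.IsOptimizationMethod Gopt ∧
      DistOpt.MIsRational Gcon ∧ DistOpt.MStrictlyCausal Gcon.toBlocks₂₂ ∧
      (∀ n ∈ N, DistOpt.IsConsensusEstimator n 2 Gcon) ∧
      H = Gcon * DistOpt.diagOne m Gopt) ∧
    (DistOpt.MStrictlyCausal H.toBlocks₁₁ →
      ∃ (Gopt : PowerSeries ℝ) (Gcon : DistOpt.AgentSystem m) (q : ℕ),
        DistOpt.StrictlyCausal Gopt ∧
        DistOpt.IsRational Gopt ∧ DistOpt.IsOptimizationMethod Gopt ∧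
        DistOpt.MIsRational Gcon ∧ DistOpt.MStrictlyCausal Gcon.toBlocks₂₂ ∧
        (∀ n ∈ N, DistOpt.IsConsensusEstimator n 2 Gcon) ∧
        (DistOpt.MStrictlyCausal H.toBlocks₂₁ → q = 0) ∧
        DistOpt.delayBlock m q * H =
          Gcon * DistOpt.diagOne m Gopt * DistOpt.delayBlock m q) := by
  open DistOpt in
  obtain ⟨n₀, hn₀⟩ := hN
  obtain ⟨k, hk, hgain⟩ := exists_gain_neg (hpos n₀ hn₀) hrat h22 (hH n₀ hn₀)
  have hr11 : MIsRational H.toBlocks₁₁ := fun i j => hrat _ _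
  have hr12 : MIsRational H.toBlocks₁₂ := fun i j => hrat _ _
  have hr21 : MIsRational H.toBlocks₂₁ := fun i j => hrat _ _
  have hr22 : MIsRational H.toBlocks₂₂ := fun i j => hrat _ _
  have hg := isRational_differencer k
  have hgi := fun p => mul_comm (differencer k) _ ▸ differencer_mul_integrator hk.ne p
  refine ⟨⟨integrator k 0, Matrix.fromBlocks (differencer k • H.toBlocks₁₁) H.toBlocks₁₂
      (differencer k • H.toBlocks₂₁) H.toBlocks₂₂, isRational_integrator k 0,
      isOptimizationMethod_integrator_zero hk, ?_⟩, fun h11 => ?_⟩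
  · have hG := (hr11.smul hg).fromBlocks hr12 (hr21.smul hg) hr22
    refine ⟨hG, by simpa using h22, fun n hn => ?_, ?_⟩
    · exact isConsensusEstimator_of_intertwined hrat h22 (hH n hn) hG (by simpa using h22) hk.ne
        hgain 0 0 (by simp [mul_comm, Matrix.toBlocks₁₁]) (by simp [Matrix.toBlocks₁₂])
        (by simp [mul_comm, Matrix.toBlocks₂₁]) (by simp [Matrix.toBlocks₂₂])
    · simp [mul_diagOne, smul_smul, hgi, Matrix.fromBlocks_toBlocks]
  · obtain ⟨F₁₁, hF₁₁⟩ := h11.exists_eq_X_smul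
    have hF11 := (hF₁₁ ▸ hr11).of_X_smul
    have e11 : H (Sum.inl ()) (Sum.inl ()) = PowerSeries.X * F₁₁ () () :=
      congrFun (congrFun hF₁₁ ()) ()
    by_cases h21 : MStrictlyCausal H.toBlocks₂₁
    · obtain ⟨F₂₁, hF₂₁⟩ := h21.exists_eq_X_smul
      have hF21 := (hF₂₁ ▸ hr21).of_X_smul
      have e21 : ∀ l, H (Sum.inr l) (Sum.inl ()) = PowerSeries.X * F₂₁ l () := fun l =>
        congrFun (congrFun hF₂₁ l) ()
      have hG := (hF11.smul hg).fromBlocks hr12 (hF21.smul hg) hr22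
      -- The whole first column of `H` has a factor `X`, which the delayed integrator absorbs, so `q
      -- = 0`. The loops of `G_con` and `H` match after delaying outputs and network variables by
      -- one step.
      refine ⟨integrator k 1, Matrix.fromBlocks (differencer k • F₁₁) H.toBlocks₁₂
        (differencer k • F₂₁) H.toBlocks₂₂, 0, strictlyCausal_integrator_one k,
        isRational_integrator k 1, isOptimizationMethod_integrator_one hk, hG, by simpa using h22,
        fun n hn => ?_, fun _ => rfl, ?_⟩
      · exact isConsensusEstimator_of_intertwined hrat h22 (hH n hn) hG (by simpa using h22) hk.ne
          hgain 1 1 (by simp [e11]; ring) (by simp [Matrix.toBlocks₁₂, mul_comm])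
          (by intro l; simp [e21]; ring) (by simp [Matrix.toBlocks₂₂])
      · simp [mul_diagOne, delayBlock_mul, mul_delayBlock, smul_smul, hgi, hF₁₁, hF₂₁]
    · obtain ⟨F₁₂, hF₁₂⟩ := (mStrictlyCausal_of_mul h2112 h21).exists_eq_X_smul
      have hF12 := (hF₁₂ ▸ hr12).of_X_smul
      have e12 : ∀ l, H (Sum.inl ()) (Sum.inr l) = PowerSeries.X * F₁₂ () l :=
        congrFun (congrFun hF₁₂ ())
      have hG := (hF11.smul hg).fromBlocks hF12 (hr21.smul hg) hr22
      -- Here the spare delay sits in `H¹²`: with `q = 1` it moves to the 21 block, where the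
      -- delayed integrator needs it. Only the output is delayed when matching loops.
      refine ⟨integrator k 1, Matrix.fromBlocks (differencer k • F₁₁) F₁₂
        (differencer k • H.toBlocks₂₁) H.toBlocks₂₂, 1, strictlyCausal_integrator_one k,
        isRational_integrator k 1, isOptimizationMethod_integrator_one hk, hG, by simpa using h22,
        fun n hn => ?_, fun h => absurd h h21, ?_⟩
      · exact isConsensusEstimator_of_intertwined hrat h22 (hH n hn) hG (by simpa using h22) hk.ne
          hgain 1 0 (by simp [e11]; ring) (by simp [e12])
          (by intro l; simp [Matrix.toBlocks₂₁, mul_comm]) (by simp [Matrix.toBlocks₂₂])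
      · simp [mul_diagOne, delayBlock_mul, mul_delayBlock, smul_smul, hgi, hF₁₁, hF₁₂]
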